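/- Let $\mathbb C$ be a semi-abelian category, i.e. a pointed, finitely cocomplete, Barr exact (regular, in particular finitely complete, with every internal equivalence relation effective) and protomodular category. Notation. For objects $G,H$ let $(G|H)$ be the kernel, with inclusion $\iota\colon (G|H)\to G+H$, of the canonical map $G+H\to G\times H$ with components $\langle 1,0\rangle$ and $\langle 0,1\rangle$; maps $f\colon G\to G'$, $g\colon H\to H'$ induce $(f|g)\colon(G|H)\to(G'|H')$. An action of $G$ on $A$ is a map $\psi\colon(A|G)\to A$ such that $q_\psi i_A\colon A\to Q_\psi$ is a monomorphism, where $i_A\colon A\to A+G$ is the inclusion and $q_\psi\colon A+G\to Q_\psi$ is the coequalizer of $\iota$ and $i_A\psi$; a subobject $b\colon B\rightarrowtail A$ is stable under a subobject $h\colon H\rightarrowtail G$ (with respect to $\psi$) if $\psi\circ(b|h)$ factors through $b$. The conjugation action of $A$ on itself is the map $c_2^A\colon (A|A)\to A$ obtained by composing $\iota\colon(A|A)\to A+A$ with the folding map $A+A\to A$. For subobjects $x\colon X\rightarrowtail A$ and $y\colon Y\rightarrowtail A$, the commutator $[X,Y]$ is the image of $c_2^A\circ(x|y)\colon (X|Y)\to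 A$, the join $X\vee Y$ is the image of $\langle x,y\rangle\colon X+Y\to A$, and $X\cap Y$ is the intersection. We say that $Y$ normalizes $X$ if $X$ is $Y$-stable under the conjugation action of $A$ on itself. A subobject is proper if its inclusion is a kernel of some map. A sequence $0\to K\xrightarrow{k}E\xrightarrow{p}Q\to0$ is short exact if $k$ is a kernel of $p$ and $p$ is a cokernel of $k$. Theorem. Let $X,Y$ be subobjects of an object $A$ of $\mathbb C$. The following conditions are equivalent: (1) $Y$ normalizes $X$; (1') $[X,Y]\subset X$; (2) $X$ is a proper subobject of $X\vee Y$; (3) $X\cap Y$ is proper in $Y$, and, writing $Y/(X\cap Y)$ for the cokernel of the inclusion $X\cap Y\to Y$ and $q\colon Y\to Y/(X\cap Y)$ for the projection, the composite of the retraction $r_Y=\langle 0,1\rangle\colon X+Y\to Y$ with $q$ factors through the canonical map $X+Y\to X\vee Y$ as a map $p\colon X\vee Y\to Y/(X\cap Y)$ such that $$0\to X\xrightarrow{x'}X\vee Y\xrightarrow{p}Y/(X\cap Y)\to 0$$ is short exact, where $x'$ is the inclusion of $X$ into $X\vee Y$. -/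

import Mathlib

open CategoryTheory CategoryTheory.Limits

universe v u

namespace SemiAb

noncomputable section

/-- A category with pullbacks is *protomodular* if, for every morphism `v : B' ⟶ B`, the pullback
functor `v^* : Pt_B ⟶ Pt_{B'}` between categories of points (split epimorphisms with a chosen
section) reflects isomorphisms: a morphism `f` of points over `B` is invertible as soon as the
morphism that it induces between the pullbacks along `v` is. -/
class Protomodular (C : Type u) [Category.{v} C] [HasPullbacks C] : Prop where
  isIso_of_isIso_pullback_map : ∀ {E E' B B' : C} (p : E ⟶ B) (s : B ⟶ E) (p' : E' ⟶ B)
    (s' : B ⟶ E') (f : E ⟶ E') (v : B' ⟶ B), s ≫ p = 𝟙 B → s' ≫ p' = 𝟙 B →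
    ∀ hp : f ≫ p' = p, s ≫ f = s' →
    IsIso (pullback.map p v p' v f (𝟙 B') (𝟙 B) (by simp [hp]) (by simp)) → IsIso f

/-- A *homological* category: pointed, regular (in particular finitely complete) and
protomodular. -/
class Homological (C : Type u) [Category.{v} C] [HasZeroMorphisms C] : Prop extends
  Regular C, HasZeroObject C, Protomodular C

/-- A *semi-abelian* category: a finitely cocomplete homological category which is Barr exact,
i.e. in which every internal equivalence relation is effective (the kernel pair of its
coequalizer). -/
class SemiAbelian (C : Type u) [Category.{v} C] [HasZeroMorphisms C] : Prop extends
  Homological C where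
  hasFiniteColimits : HasFiniteColimits C
  isEffective : ∀ {R X : C} (p₁ p₂ : R ⟶ X), IsEquivalenceRelation p₁ p₂ →
    IsEffectiveEquivalenceRelation p₁ p₂

attribute [instance] SemiAbelian.hasFiniteColimits

section CrossEffect

variable {C : Type u} [Category.{v} C] [HasZeroMorphisms C] [HasFiniteLimits C]
  [HasFiniteColimits C]

/-- The canonical map `b : X + Y ⟶ X × Y`, whose components are the canonical retractions
`r_X` and `r_Y`. -/
def coprodToProd (X Y : C) : X ⨿ Y ⟶ X ⨯ Y :=
  prod.lift (coprod.desc (𝟙 X) 0) (coprod.desc 0 (𝟙 Y))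

/-- The second cross-effect `(X|Y)` of the identity functor. -/
def crossEffect (X Y : C) : C := kernel (coprodToProd X Y)

/-- The inclusion `ι : (X|Y) ⟶ X + Y`. -/
def crossEffectι (X Y : C) : crossEffect X Y ⟶ X ⨿ Y := kernel.ι (coprodToProd X Y)

/-- The functoriality `(f|g) : (X|Y) ⟶ (X'|Y')` of the cross-effect. -/
def crossEffectMap {X Y X' Y' : C} (f : X ⟶ X') (g : Y ⟶ Y') :
    crossEffect X Y ⟶ crossEffect X' Y' :=
  kernel.map (coprodToProd X Y) (coprodToProd X' Y') (coprod.map f g) (prod.map f g)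
    (by ext <;> simp [coprodToProd])

/-- An (internal) *action* of `G` on `A`: a map `ψ : (A|G) ⟶ A` such that `q_ψ ∘ i_A` is a
monomorphism, where `q_ψ : A + G ⟶ Q_ψ` is the coequalizer of `ι` and `i_A ∘ ψ`. -/
structure InternalAction (G A : C) where
  act : crossEffect A G ⟶ A
  mono : Mono ((coprod.inl : A ⟶ A ⨿ G) ≫ coequalizer.π (crossEffectι A G) (act ≫ coprod.inl))

/-- For an action `ψ` of `G` on `A`, the subobject `B` of `A` is *stable* under the subobject `H`
of `G` if `ψ ∘ (b|h) : (B|H) ⟶ A` factors through `b : B ⟶ A`. -/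
def InternalAction.IsStable {G A : C} (ψ : InternalAction G A) (B : Subobject A)
    (H : Subobject G) : Prop :=
  ∃ ψ' : crossEffect (B : C) (H : C) ⟶ (B : C),
    ψ' ≫ B.arrow = crossEffectMap B.arrow H.arrow ≫ ψ.act

/-- The (binary) commutator map `c₂ : (A|A) ⟶ A`, the composite of `ι` with the folding map. -/
def commutatorMap (A : C) : crossEffect A A ⟶ A :=
  crossEffectι A A ≫ coprod.desc (𝟙 A) (𝟙 A)

/-- The *conjugation action* of an object on itself, given by the commutator map. -/
def conjugationAction (A : C) : InternalAction A A where
  act := commutatorMap A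
  mono := by
    have h0 : crossEffectι A A ≫ coprod.desc 0 (𝟙 A) = 0 := by
      have h := kernel.condition (coprodToProd A A) =≫ prod.snd
      rwa [Category.assoc, coprodToProd, prod.lift_snd, zero_comp] at h
    -- the map `A + A ⟶ A × A` with components `(1, 0)` and the diagonal identifies the two maps
    -- whose coequalizer is formed, and restricts to the monomorphism `(1, 0)` on the first summand
    have h : crossEffectι A A ≫ coprod.desc (prod.lift (𝟙 A) 0) (prod.lift (𝟙 A) (𝟙 A)) =
        (commutatorMap A ≫ coprod.inl) ≫
          coprod.desc (prod.lift (𝟙 A) 0) (prod.lift (𝟙 A) (𝟙 A)) := by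
      rw [Category.assoc, coprod.inl_desc]
      apply Limits.prod.hom_ext
      · rw [Category.assoc, Category.assoc, coprod.desc_comp, prod.lift_fst, prod.lift_fst,
          Category.comp_id, commutatorMap]
      · rw [Category.assoc, Category.assoc, coprod.desc_comp, prod.lift_snd, prod.lift_snd, h0,
          comp_zero]
    have e : ((coprod.inl : A ⟶ A ⨿ A) ≫
        coequalizer.π (crossEffectι A A) (commutatorMap A ≫ coprod.inl)) ≫
          coequalizer.desc _ h = prod.lift (𝟙 A) 0 := by
      rw [Category.assoc, coequalizer.π_desc, coprod.inl_desc]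
    exact mono_of_mono_fac e

/-- `Y` *normalizes* `X` if `X` is `Y`-stable under the conjugation action of `A` on itself. -/
def Normalizes {A : C} (Y X : Subobject A) : Prop :=
  (conjugationAction A).IsStable X Y

/-- The *commutator* `[X, Y]` of two subobjects of `A`: the image of the composite
`(X|Y) ⟶ (A|A) ⟶ A`. -/
def subobjectCommutator [HasImages C] {A : C} (X Y : Subobject A) : Subobject A :=
  imageSubobject (crossEffectMap X.arrow Y.arrow ≫ commutatorMap A)

/-- A morphism is the inclusion of a *proper* subobject if it is a kernel of some morphism. -/
def IsProper {X A : C} (m : X ⟶ A) : Prop := Nonempty (NormalMono m)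

/-- The sequence `0 ⟶ K ⟶ E ⟶ Q ⟶ 0` is *short exact*: `k` is a kernel of `p` and `p` is a
cokernel of `k`. -/
def IsShortExact {K E Q : C} (k : K ⟶ E) (p : E ⟶ Q) : Prop :=
  ∃ w : k ≫ p = 0, Nonempty (IsLimit (KernelFork.ofι k w)) ∧
    Nonempty (IsColimit (CokernelCofork.ofπ p w))

end CrossEffect

end

end SemiAb

/-!
The tool throughout is the form of protomodularity proved in
`SemiAb.exists_fac_of_section_of_kernel`: for a split epimorphism `p` with section `s`, a morphism
out of the domain of `p` takes values in a given subobject as soon as its restrictions to `s` and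
to the kernel of `p` do. Three standard facts follow from it.

* Every regular epimorphism is a cokernel of its kernel
  (`SemiAb.exists_desc_of_kernel_comp_eq_zero`).
* Every reflexive relation is an equivalence relation
  (`SemiAb.isEquivalenceRelation_of_reflexiveRelation`).
* With Barr exactness, the image of a kernel along a regular epimorphism `e` is a kernel
  (`SemiAb.isProper_of_regular_image`): the direct image along `e` of the kernel pair of `f` is a
  reflexive relation, hence the kernel pair of some `g`, and the kernel of `g` is the image of the
  kernel of `f`.

Suppose that `Y` normalizes `X`. The kernel `N` of the retraction `r_Y : X + Y ⟶ Y` is split over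
`X` by the other retraction, with kernel `(X|Y)`, so it is generated by `X` and `(X|Y)`. The
covering `X + Y ⟶ X ⊔ Y` maps both of these into `X`, so `X` is the image of the kernel `N` and is
proper in `X ⊔ Y`. Conversely, if `X` is the kernel of some `g` on `X ⊔ Y`, then the
composite `X + Y ⟶ X ⊔ Y` with `g` factors through `r_Y`, which vanishes on `(X|Y)`; so `(X|Y)` is
mapped into `X`. Finally, if `π` is the cokernel of a proper `X ⟶ X ⊔ Y`, then `Y ⟶ X ⊔ Y`
followed by `π` is a regular epimorphism with kernel `X ⊓ Y`, hence it is the cokernel of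
`X ⊓ Y ⟶ Y`, which is the second isomorphism theorem.
-/

namespace SemiAb

section

-- the simp lemmas about general limits do not see through the cones of these shapes
attribute [local simp] prod.lift_fst prod.lift_snd prod.lift_fst_assoc prod.lift_snd_assoc
  pullback.lift_fst pullback.lift_snd pullback.lift_fst_assoc pullback.lift_snd_assoc
  kernel.lift_ι kernel.lift_ι_assoc coprod.inl_desc coprod.inr_desc coprod.inl_desc_assoc
  coprod.inr_desc_assoc

/-! ### Consequences of protomodularity -/

section Homological

variable {C : Type u} [Category.{v} C] [HasZeroMorphisms C] [Homological C]

/-- A monomorphism through which both the section and the kernel of a split epimorphism factor is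
invertible. -/
theorem isIso_of_section_of_kernel {E B M : C} {p : E ⟶ B} {s : B ⟶ E} (hs : s ≫ p = 𝟙 B)
    (m : M ⟶ E) [Mono m] (h₁ : ∃ u, u ≫ m = s) (h₂ : ∃ u, u ≫ m = kernel.ι p) : IsIso m := by
  obtain ⟨u, hu⟩ := h₁
  obtain ⟨w, hw⟩ := h₂
  let z : (HasZeroObject.zero' C).zero ⟶ B := 0
  have hz : ∀ {T : C} (a b : T ⟶ (HasZeroObject.zero' C).zero), a = b := fun a b =>
    (HasZeroObject.zeroIsTerminal (C := C)).hom_ext a b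
  -- over the zero object, the points `m ≫ p` and `p` become their kernels
  refine Protomodular.isIso_of_isIso_pullback_map (m ≫ p) u p s m z
    (by rw [← Category.assoc, hu, hs]) hs rfl hu ?_
  have h0 : pullback.fst p z ≫ p = 0 := by
    rw [pullback.condition]; simp [z]
  refine ⟨pullback.lift (kernel.lift p _ h0 ≫ w) (pullback.snd p z) ?_, ?_, ?_⟩
  · rw [Category.assoc, reassoc_of% hw, kernel.lift_ι_assoc, pullback.condition]
  · apply pullback.hom_ext
    · simp [← cancel_mono m, hw]
    · exact hz _ _
  · apply pullback.hom_ext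
    · simp [hw]
    · exact hz _ _

theorem exists_fac_of_section_of_kernel {E B D M : C} {p : E ⟶ B} {s : B ⟶ E}
    (hs : s ≫ p = 𝟙 B) (m : M ⟶ D) [Mono m] (f : E ⟶ D) (h₁ : ∃ u, u ≫ m = s ≫ f)
    (h₂ : ∃ u, u ≫ m = kernel.ι p ≫ f) : ∃ u, u ≫ m = f := by
  obtain ⟨u, hu⟩ := h₁
  obtain ⟨w, hw⟩ := h₂
  have := isIso_of_section_of_kernel hs (pullback.fst f m)
    ⟨pullback.lift s u hu.symm, by simp⟩ ⟨pullback.lift (kernel.ι p) w hw.symm, by simp⟩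
  exact ⟨inv (pullback.fst f m) ≫ pullback.snd f m, by simp [← pullback.condition]⟩

theorem hom_ext_of_section_of_kernel {E B D : C} {p : E ⟶ B} {s : B ⟶ E} (hs : s ≫ p = 𝟙 B)
    {f g : E ⟶ D} (h₁ : s ≫ f = s ≫ g) (h₂ : kernel.ι p ≫ f = kernel.ι p ≫ g) : f = g := by
  obtain ⟨u, hu⟩ := exists_fac_of_section_of_kernel hs (equalizer.ι f g) (𝟙 E)
    ⟨equalizer.lift s h₁, by simp⟩ ⟨equalizer.lift (kernel.ι p) h₂, by simp⟩
  rw [← Category.id_comp f, ← Category.id_comp g, ← hu, Category.assoc, equalizer.condition,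
    Category.assoc]

/-- A regular epimorphism is a cokernel of its kernel: existence of the descended morphism. -/
theorem exists_desc_of_kernel_comp_eq_zero {E J Z : C} (e : E ⟶ J) [IsRegularEpi e] (h : E ⟶ Z)
    (hh : kernel.ι e ≫ h = 0) : ∃ d, e ≫ d = h := by
  -- the kernel pair of `e` is generated by the diagonal and by the pairs `(0, b)` with `b` in the
  -- kernel of `e`, and on both of these the two projections agree after `h`
  have hfs : pullback.fst e e ≫ h = pullback.snd e e ≫ h := by
    refine hom_ext_of_section_of_kernel (p := pullback.fst e e)
      (s := pullback.lift (𝟙 E) (𝟙 E) rfl) (by simp) (by simp) ?_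
    have h0 : (kernel.ι (pullback.fst e e) ≫ pullback.snd e e) ≫ e = 0 := by
      rw [Category.assoc, ← pullback.condition, kernel.condition_assoc, zero_comp]
    rw [kernel.condition_assoc, zero_comp, ← Category.assoc, ← kernel.lift_ι e _ h0,
      Category.assoc, hh, comp_zero]
  let r := IsRegularEpi.getStruct e
  have hr : r.left ≫ h = r.right ≫ h := by
    have := pullback.lift r.left r.right r.w ≫= hfs
    simpa using this
  exact ⟨Cofork.IsColimit.desc r.isColimit h hr, Cofork.IsColimit.π_desc' r.isColimit h hr⟩

theorem mono_prodLift_of_jointlyMono {R X Y : C} {p₁ : R ⟶ X} {p₂ : R ⟶ Y}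
    (h : JointlyMono₂ p₁ p₂) : Mono (prod.lift p₁ p₂) :=
  ⟨fun a b hab => h.right_cancellation a b
    (by simpa using hab =≫ prod.fst) (by simpa using hab =≫ prod.snd)⟩

/-- The image of a span as a relation. -/
theorem exists_regularEpi_jointlyMono_fac {R X Y : C} (a : R ⟶ X) (b : R ⟶ Y) :
    ∃ (S : C) (ρ : R ⟶ S) (s₁ : S ⟶ X) (s₂ : S ⟶ Y), IsRegularEpi ρ ∧ JointlyMono₂ s₁ s₂ ∧
      ρ ≫ s₁ = a ∧ ρ ≫ s₂ = b := by
  let F := Regular.strongEpiMonoFactorisation (prod.lift a b)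
  refine ⟨F.I, F.e, F.m ≫ prod.fst, F.m ≫ prod.snd, inferInstance, ⟨fun T u w h₁ h₂ => ?_⟩,
    by simp, by simp⟩
  rw [← cancel_mono F.m]
  ext
  · simpa using h₁
  · simpa using h₂

/-- In a homological category, every reflexive relation is an equivalence relation, i.e. the
category is Mal'tsev. -/
theorem isEquivalenceRelation_of_reflexiveRelation {R X : C} {p₁ p₂ : R ⟶ X}
    (h : ReflexiveRelation p₁ p₂) : IsEquivalenceRelation p₁ p₂ := by
  have : Mono (prod.lift p₁ p₂) := mono_prodLift_of_jointlyMono h.toJointlyMono₂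
  -- the relation is Euclidean: if `a R b` and `a R c`, then `b R c`. The pairs of such pairs are
  -- split over the pairs `a R b` by `c = b`, and on the kernel of this splitting `a = b = 0`.
  obtain ⟨t, ht⟩ := exists_fac_of_section_of_kernel (p := pullback.fst p₁ p₁)
    (s := pullback.lift (𝟙 R) (𝟙 R) rfl) (by simp) (prod.lift p₁ p₂)
    (prod.lift (pullback.fst p₁ p₁ ≫ p₂) (pullback.snd p₁ p₁ ≫ p₂))
    ⟨p₂ ≫ h.r, by ext <;> simp⟩
    ⟨kernel.ι (pullback.fst p₁ p₁) ≫ pullback.snd p₁ p₁, by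
      ext
      · simp [← pullback.condition]
      · simp⟩
  have ht₁ : t ≫ p₁ = pullback.fst p₁ p₁ ≫ p₂ := by simpa using ht =≫ prod.fst
  have ht₂ : t ≫ p₂ = pullback.snd p₁ p₁ ≫ p₂ := by simpa using ht =≫ prod.snd
  let σ : R ⟶ R := pullback.lift (𝟙 R) (p₁ ≫ h.r) (by simp) ≫ t
  have hσ₁ : σ ≫ p₁ = p₂ := by simp [σ, ht₁]
  have hσ₂ : σ ≫ p₂ = p₁ := by simp [σ, ht₂]
  exact ⟨⟨{ h with
    s := σ
    symmetry₁ := hσ₁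
    symmetry₂ := hσ₂
    c := pullback.cone p₂ p₁
    isLimit := pullback.isLimit p₂ p₁
    t := pullback.lift (pullback.fst p₂ p₁ ≫ σ) (pullback.snd p₂ p₁)
      (by simp [hσ₁, pullback.condition]) ≫ t
    transitivity₁ := by simp [ht₁, hσ₂]
    transitivity₂ := by simp [ht₂] }⟩⟩

end Homological

/-! ### Images of kernels along regular epimorphisms -/

variable {C : Type u} [Category.{v} C] [HasZeroMorphisms C] [SemiAbelian C]

/-- In a semi-abelian category, the image of a kernel along a regular epimorphism is a kernel. -/
theorem isProper_of_regular_image {E B J X : C} (f : E ⟶ B) (e : E ⟶ J) [IsRegularEpi e]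
    (x : X ⟶ J) [Mono x] (a : kernel f ⟶ X) [StrongEpi a] (ha : a ≫ x = kernel.ι f ≫ e) :
    IsProper x := by
  obtain ⟨S, ρ, s₁, s₂, _, hjm, hρ₁, hρ₂⟩ :=
    exists_regularEpi_jointlyMono_fac (pullback.fst f f ≫ e) (pullback.snd f f ≫ e)
  have : Mono (prod.lift s₁ s₂) := mono_prodLift_of_jointlyMono hjm
  -- the direct image contains the diagonal of `J`, because `e` is a strong epimorphism
  have hsq : CommSq (pullback.lift (𝟙 E) (𝟙 E) rfl ≫ ρ) e (prod.lift s₁ s₂)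
      (prod.lift (𝟙 J) (𝟙 J)) := ⟨by ext <;> simp [hρ₁, hρ₂]⟩
  have hr : hsq.lift ≫ prod.lift s₁ s₂ = prod.lift (𝟙 J) (𝟙 J) := hsq.fac_right
  have hrefl : ReflexiveRelation s₁ s₂ :=
    { hjm with
      r := hsq.lift
      reflexivity₁ := by simpa using hr =≫ prod.fst
      reflexivity₂ := by simpa using hr =≫ prod.snd }
  obtain ⟨⟨G⟩⟩ := SemiAbelian.isEffective s₁ s₂ (isEquivalenceRelation_of_reflexiveRelation hrefl)
  have hx : x ≫ G.π = 0 := by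
    -- the pairs `(0, n)` with `n` in the kernel of `f` belong to the kernel pair of `f`
    rw [← cancel_epi a, reassoc_of% ha, comp_zero]
    have h := (pullback.lift 0 (kernel.ι f) (by simp) ≫ ρ) ≫= G.isKernelPair.w
    rw [Category.assoc, Category.assoc, reassoc_of% hρ₁, reassoc_of% hρ₂] at h
    simpa using h.symm
  -- the part of the kernel pair of `f` over the kernel of `e` is generated by the diagonal and by
  -- the kernel of `f`, so its second projection followed by `e` takes values in `X`
  let W := pullback (pullback.fst f f) (kernel.ι e)
  let w : W ⟶ pullback f f := pullback.fst (pullback.fst f f) (kernel.ι e)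
  have hw : w ≫ pullback.fst f f = pullback.snd (pullback.fst f f) (kernel.ι e) ≫ kernel.ι e :=
    pullback.condition
  obtain ⟨c, hc⟩ := exists_fac_of_section_of_kernel
    (p := pullback.snd (pullback.fst f f) (kernel.ι e))
    (s := pullback.lift (kernel.ι e ≫ pullback.lift (𝟙 E) (𝟙 E) rfl) (𝟙 _) (by simp)) (by simp) x
    (w ≫ pullback.snd f f ≫ e) ⟨0, by simp [w]⟩
    ⟨kernel.lift f (kernel.ι _ ≫ w ≫ pullback.snd f f) (by
        rw [Category.assoc, Category.assoc, ← pullback.condition, reassoc_of% hw,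
          kernel.condition_assoc, zero_comp]) ≫ a, by simp [ha]⟩
  refine ⟨⟨G.B, G.π, hx, KernelFork.IsLimit.ofι' x hx
    fun {T} k hk => Classical.indefiniteDescription _ ?_⟩⟩
  let l : T ⟶ S := G.isKernelPair.lift 0 k (by simp [hk])
  have hl₁ : l ≫ s₁ = 0 := G.isKernelPair.lift_fst _ _ _
  have hl₂ : l ≫ s₂ = k := G.isKernelPair.lift_snd _ _ _
  -- the lift of `k` to the relation is covered by pairs in the kernel pair of `f`, and these lie
  -- in `W`
  let v : pullback ρ l ⟶ W := pullback.lift (pullback.fst ρ l)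
    (kernel.lift e (pullback.fst ρ l ≫ pullback.fst f f) (by
      rw [Category.assoc, ← hρ₁, reassoc_of% (pullback.condition (f := ρ) (g := l)), hl₁,
        comp_zero])) (by simp)
  have hv : v ≫ w = pullback.fst ρ l := pullback.lift_fst _ _ _
  have hk' : CommSq (v ≫ c) (pullback.snd ρ l) x k :=
    ⟨by
      rw [Category.assoc, hc, reassoc_of% hv, ← hρ₂,
        reassoc_of% (pullback.condition (f := ρ) (g := l)), hl₂]⟩
  exact ⟨hk'.lift, hk'.fac_right⟩

/-! ### Joins and commutators -/

/-- A monomorphism into `X ⊔ Y` through which both `X` and `Y` factor is invertible, so the covering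
of the join by the coproduct is an extremal epimorphism. -/
theorem isRegularEpi_coprodDesc_sup {A : C} (X Y : Subobject A) :
    IsRegularEpi (coprod.desc (Subobject.ofLE X (X ⊔ Y) le_sup_left)
      (Subobject.ofLE Y (X ⊔ Y) le_sup_right)) := by
  have hepi : ∀ {M : C} (m : M ⟶ ((X ⊔ Y : Subobject A) : C)) [Mono m]
      (u : (X : C) ⨿ (Y : C) ⟶ M), u ≫ m = coprod.desc (Subobject.ofLE X (X ⊔ Y) le_sup_left)
      (Subobject.ofLE Y (X ⊔ Y) le_sup_right) → IsIso m := by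
    intro M m _ u hu
    have hle : X ⊔ Y ≤ Subobject.mk (m ≫ (X ⊔ Y).arrow) := by
      refine sup_le (Subobject.le_mk_of_comm (coprod.inl ≫ u) ?_)
        (Subobject.le_mk_of_comm (coprod.inr ≫ u) ?_)
      · simp [reassoc_of% hu]
      · simp [reassoc_of% hu]
    have hm : Subobject.ofLEMk _ _ hle ≫ m = 𝟙 _ := by
      simp [← cancel_mono (X ⊔ Y).arrow]
    exact ⟨_, by simp [← cancel_mono m, hm], hm⟩
  have : ExtremalEpi (coprod.desc (Subobject.ofLE X (X ⊔ Y) le_sup_left)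
      (Subobject.ofLE Y (X ⊔ Y) le_sup_right)) :=
    { left_cancellation := fun g h hgh => by
        have := hepi (equalizer.ι g h) (equalizer.lift _ hgh) (by simp)
        rw [← cancel_epi (equalizer.ι g h), equalizer.condition]
      isIso := fun u m hu _ => hepi m u hu }
  infer_instance

theorem crossEffectι_comp_desc_zero_id (X Y : C) :
    crossEffectι X Y ≫ coprod.desc 0 (𝟙 Y) = 0 := by
  have h := kernel.condition (coprodToProd X Y) =≫ prod.snd
  rwa [Category.assoc, coprodToProd, prod.lift_snd, zero_comp] at h

theorem exists_comp_crossEffectι_eq {T X Y : C} (k : T ⟶ X ⨿ Y)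
    (h₁ : k ≫ coprod.desc (𝟙 X) 0 = 0) (h₂ : k ≫ coprod.desc 0 (𝟙 Y) = 0) :
    ∃ l : T ⟶ crossEffect X Y, l ≫ crossEffectι X Y = k := by
  have h : k ≫ coprodToProd X Y = 0 := by
    apply Limits.prod.hom_ext
    · rw [Category.assoc, coprodToProd, prod.lift_fst, h₁, zero_comp]
    · rw [Category.assoc, coprodToProd, prod.lift_snd, h₂, zero_comp]
  exact ⟨kernel.lift _ k h, kernel.lift_ι _ _ _⟩

/-- The restriction of the commutator map to `(X|Y)`, computed through the join. -/
theorem crossEffectMap_comp_commutatorMap {A : C} (X Y : Subobject A) :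
    crossEffectMap X.arrow Y.arrow ≫ commutatorMap A =
      crossEffectι (X : C) (Y : C) ≫ coprod.desc (Subobject.ofLE X (X ⊔ Y) le_sup_left)
        (Subobject.ofLE Y (X ⊔ Y) le_sup_right) ≫ (X ⊔ Y).arrow := by
  have h : crossEffectMap X.arrow Y.arrow ≫ crossEffectι A A =
      crossEffectι (X : C) (Y : C) ≫ coprod.map X.arrow Y.arrow :=
    kernel.lift_ι _ _ _
  rw [commutatorMap, reassoc_of% h]
  simp

theorem normalizes_iff_commutator_le {A : C} (X Y : Subobject A) :
    Normalizes Y X ↔ subobjectCommutator X Y ≤ X := by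
  constructor
  · rintro ⟨ψ, hψ⟩
    exact imageSubobject_le _ ψ hψ
  · intro h
    refine ⟨factorThruImageSubobject _ ≫ Subobject.ofLE _ _ h, ?_⟩
    refine (Category.assoc _ _ _).trans ?_
    refine (congrArg _ (Subobject.ofLE_arrow h)).trans ?_
    exact imageSubobject_arrow_comp _

/-- The kernel of the retraction `X + Y ⟶ Y` is generated by `X` and `(X|Y)`, so its image in the
join is `X` as soon as `Y` normalizes `X`. -/
theorem isProper_of_normalizes {A : C} {X Y : Subobject A} (h : Normalizes Y X) :
    IsProper (Subobject.ofLE X (X ⊔ Y) le_sup_left) := by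
  obtain ⟨ψ, hψ⟩ := h
  have hψ' : ψ ≫ X.arrow = crossEffectMap X.arrow Y.arrow ≫ commutatorMap A := hψ
  rw [crossEffectMap_comp_commutatorMap] at hψ'
  have := isRegularEpi_coprodDesc_sup X Y
  set e := coprod.desc (Subobject.ofLE X (X ⊔ Y) le_sup_left)
    (Subobject.ofLE Y (X ⊔ Y) le_sup_right) with he
  let f : (X : C) ⨿ (Y : C) ⟶ (Y : C) := coprod.desc 0 (𝟙 _)
  let g : (X : C) ⨿ (Y : C) ⟶ (X : C) := coprod.desc (𝟙 _) 0
  let s : (X : C) ⟶ kernel f := kernel.lift f coprod.inl (by simp [f])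
  have hs : s ≫ kernel.ι f = coprod.inl := kernel.lift_ι _ _ _
  obtain ⟨l, hl⟩ := exists_comp_crossEffectι_eq (kernel.ι (kernel.ι f ≫ g) ≫ kernel.ι f)
    (by rw [Category.assoc]; exact kernel.condition (kernel.ι f ≫ g))
    (by rw [Category.assoc, show kernel.ι f ≫ coprod.desc 0 (𝟙 _) = 0 from kernel.condition f,
      comp_zero])
  obtain ⟨a, ha⟩ := exists_fac_of_section_of_kernel (p := kernel.ι f ≫ g) (s := s)
    (by simp [reassoc_of% hs, g]) (Subobject.ofLE X (X ⊔ Y) le_sup_left) (kernel.ι f ≫ e)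
    ⟨𝟙 _, by simp [reassoc_of% hs, he]⟩
    ⟨l ≫ ψ, by
      rw [← cancel_mono (X ⊔ Y).arrow, Category.assoc, Category.assoc, Subobject.ofLE_arrow, hψ',
        reassoc_of% hl]
      simp only [Category.assoc]⟩
  have hsa : s ≫ a = 𝟙 _ := by
    rw [← cancel_mono (Subobject.ofLE X (X ⊔ Y) le_sup_left), Category.assoc, ha,
      reassoc_of% hs]
    simp [he]
  have : IsSplitEpi a := ⟨⟨⟨s, hsa⟩⟩⟩
  exact isProper_of_regular_image f e _ a ha

theorem normalizes_of_isProper {A : C} {X Y : Subobject A}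
    (h : IsProper (Subobject.ofLE X (X ⊔ Y) le_sup_left)) : Normalizes Y X := by
  obtain ⟨⟨Z, g, w, hl⟩⟩ := h
  have hfac : coprod.desc (Subobject.ofLE X (X ⊔ Y) le_sup_left)
      (Subobject.ofLE Y (X ⊔ Y) le_sup_right) ≫ g =
      coprod.desc 0 (𝟙 _) ≫ Subobject.ofLE Y (X ⊔ Y) le_sup_right ≫ g := by
    ext <;> simp [w]
  have h0 : (crossEffectι (X : C) (Y : C) ≫ coprod.desc (Subobject.ofLE X (X ⊔ Y) le_sup_left)
      (Subobject.ofLE Y (X ⊔ Y) le_sup_right)) ≫ g = 0 := by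
    rw [Category.assoc, hfac, reassoc_of% (crossEffectι_comp_desc_zero_id (X : C) (Y : C)),
      zero_comp]
  obtain ⟨l, hl⟩ := KernelFork.IsLimit.lift' hl _ h0
  refine ⟨l, ?_⟩
  change l ≫ X.arrow = crossEffectMap X.arrow Y.arrow ≫ commutatorMap A
  rw [crossEffectMap_comp_commutatorMap, ← Category.assoc, ← hl]
  simp

/-! ### The second isomorphism theorem -/

theorem isProper_inf_and_exists_isShortExact {A : C} {X Y : Subobject A}
    (h : IsProper (Subobject.ofLE X (X ⊔ Y) le_sup_left)) :
    IsProper (Subobject.ofLE (X ⊓ Y) Y inf_le_right) ∧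
      ∃ p : ((X ⊔ Y : Subobject A) : C) ⟶ cokernel (Subobject.ofLE (X ⊓ Y) Y inf_le_right),
        coprod.desc (Subobject.ofLE X (X ⊔ Y) le_sup_left)
            (Subobject.ofLE Y (X ⊔ Y) le_sup_right) ≫ p =
          coprod.desc 0 (𝟙 (Y : C)) ≫ cokernel.π (Subobject.ofLE (X ⊓ Y) Y inf_le_right) ∧
        IsShortExact (Subobject.ofLE X (X ⊔ Y) le_sup_left) p := by
  obtain ⟨⟨Z, g, w, hl⟩⟩ := h
  have := isRegularEpi_coprodDesc_sup X Y
  set x := Subobject.ofLE X (X ⊔ Y) le_sup_left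
  set y := Subobject.ofLE Y (X ⊔ Y) le_sup_right
  set i := Subobject.ofLE (X ⊓ Y) Y inf_le_right
  let π := cokernel.π x
  -- a kernel is a kernel of its cokernel
  have hker : ∀ {T : C} (k : T ⟶ ((X ⊔ Y : Subobject A) : C)), k ≫ π = 0 → ∃ l, l ≫ x = k := by
    intro T k hk
    have hg : k ≫ g = 0 := by
      rw [← cokernel.π_desc x g w, reassoc_of% hk, zero_comp]
    obtain ⟨l, hl⟩ := KernelFork.IsLimit.lift' hl k hg
    exact ⟨l, hl⟩
  have hxy : Subobject.ofLE (X ⊓ Y) X inf_le_left ≫ x = i ≫ y := by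
    simp [x, y, i]
  have hiy : i ≫ y ≫ π = 0 := by
    rw [← Category.assoc, ← hxy, Category.assoc, cokernel.condition, comp_zero]
  have hkery : ∀ {T : C} (k : T ⟶ (Y : C)), k ≫ y ≫ π = 0 → ∃ l, l ≫ i = k := by
    intro T k hk
    obtain ⟨l, hl⟩ := hker (k ≫ y) (by simpa using hk)
    have hlk : l ≫ X.arrow = k ≫ Y.arrow := by
      have := hl =≫ (X ⊔ Y).arrow
      simpa [x, y] using this
    exact ⟨(Subobject.inf_isPullback X Y).lift l k hlk,
      (Subobject.inf_isPullback X Y).lift_snd _ _ _⟩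
  have hfac : coprod.desc x y ≫ π = coprod.desc 0 (𝟙 (Y : C)) ≫ y ≫ π := by
    ext <;> simp [π]
  -- `π` restricted to `Y` is still a strong epimorphism, since `π` vanishes on `X`
  have : StrongEpi (coprod.desc 0 (𝟙 (Y : C)) ≫ y ≫ π : (X : C) ⨿ (Y : C) ⟶ _) := by
    rw [← hfac]
    exact strongEpi_comp _ _
  have : StrongEpi (y ≫ π) :=
    strongEpi_of_strongEpi (coprod.desc 0 (𝟙 (Y : C)) : (X : C) ⨿ (Y : C) ⟶ _) (y ≫ π)
  obtain ⟨l, hl⟩ := hkery (kernel.ι (y ≫ π)) (kernel.condition _)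
  -- `y ≫ π` is a regular epimorphism with kernel `i`, so the cokernel of `i` factors through it
  obtain ⟨d, hd⟩ := exists_desc_of_kernel_comp_eq_zero (y ≫ π) (cokernel.π i)
    (by rw [← hl, Category.assoc, cokernel.condition, comp_zero])
  have hdd : d ≫ cokernel.desc i (y ≫ π) hiy = 𝟙 _ := by
    rw [← cancel_epi (y ≫ π), ← Category.assoc, hd, cokernel.π_desc, Category.comp_id]
  have hdd' : cokernel.desc i (y ≫ π) hiy ≫ d = 𝟙 _ := by
    rw [← cancel_epi (cokernel.π i), cokernel.π_desc_assoc, hd, Category.comp_id]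
  have : IsIso d := ⟨_, hdd, hdd'⟩
  have : Epi π := inferInstanceAs (Epi (cokernel.π x))
  refine ⟨⟨⟨_, y ≫ π, hiy, KernelFork.IsLimit.ofι' i hiy
    fun k hk => Classical.indefiniteDescription _ (hkery k hk)⟩⟩, π ≫ d, ?_, ?_⟩
  · rw [reassoc_of% hfac, ← hd, Category.assoc]
  · have hw : x ≫ π ≫ d = 0 := by simp [π]
    refine ⟨hw, ⟨KernelFork.IsLimit.ofι' x hw fun k hk =>
      Classical.indefiniteDescription _ (hker k ?_)⟩, ⟨CokernelCofork.IsColimit.ofπ' _ hw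
      fun k hk => ⟨cokernel.desc i (y ≫ π) hiy ≫ cokernel.desc x k hk, ?_⟩⟩⟩
    · have := hk =≫ cokernel.desc i (y ≫ π) hiy
      simpa [hdd] using this
    · simp [reassoc_of% hdd, π]

end

end SemiAb

theorem mainTheorem1 {C : Type u} [Category.{v} C] [HasZeroMorphisms C] [SemiAb.SemiAbelian C]
    {A : C} (X Y : Subobject A) :
    List.TFAE [
      -- `Y` normalizes `X`, in its two forms
      SemiAb.Normalizes Y X,
      SemiAb.subobjectCommutator X Y ≤ X,
      -- `X` is proper in the join
      SemiAb.IsProper (Subobject.ofLE X (X ⊔ Y) le_sup_left),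
      -- the meet is proper in `Y`, and `0 ⟶ X ⟶ X ⊔ Y ⟶ Y / (X ⊓ Y) ⟶ 0` is short exact, where the
      -- second map `p` is the one through which the composite `X + Y ⟶ Y ⟶ Y / (X ⊓ Y)` factors
      SemiAb.IsProper (Subobject.ofLE (X ⊓ Y) Y inf_le_right) ∧
        ∃ p : ((X ⊔ Y : Subobject A) : C) ⟶ cokernel (Subobject.ofLE (X ⊓ Y) Y inf_le_right),
          coprod.desc (Subobject.ofLE X (X ⊔ Y) le_sup_left)
              (Subobject.ofLE Y (X ⊔ Y) le_sup_right) ≫ p =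
            coprod.desc 0 (𝟙 (Y : C)) ≫ cokernel.π (Subobject.ofLE (X ⊓ Y) Y inf_le_right) ∧
          SemiAb.IsShortExact (Subobject.ofLE X (X ⊔ Y) le_sup_left) p] := by
  tfae_have 1 ↔ 2 := SemiAb.normalizes_iff_commutator_le X Y
  tfae_have 1 → 3 := SemiAb.isProper_of_normalizes
  tfae_have 3 → 1 := SemiAb.normalizes_of_isProper
  tfae_have 3 → 4 := SemiAb.isProper_inf_and_exists_isShortExact
  tfae_have 4 → 3 := fun ⟨_, p, _, w, ⟨hk⟩, _⟩ => ⟨⟨_, p, w, hk⟩⟩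
  tfae_finish
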